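/- Let $\mathcal B=\{x\in\mathbb R^d:\|x\|\le 1\}$ denote the closed Euclidean unit ball. A random vector $a$ in $\mathbb R^d$ is called $\Sigma$-subgaussian, for a (symmetric) positive definite matrix $\Sigma\in\mathbb R^{d\times d}$, if $$\mathbb P(|a^\top x|>t)\le 2\exp\Big(-\frac12\,\frac{t^2}{x^\top\Sigma x}\Big)\qquad\text{for all } t>0,\ x\in\mathcal B .$$ Let $\sigma_1^2\ge\cdots\ge\sigma_d^2>0$ be the eigenvalues of $\Sigma$, with multiplicity, $\sigma_i>0$, and for every integer $r\ge1$ let $d_{\rm eff}(r)=\sum_{i=1}^d(\sigma_i/\sigma_1)^{2/r}$. There is a universal constant $c>0$ such that the following holds for every $d\ge2$, every positive definite $\Sigma\in\mathbb R^{d\times d}$, every $\Sigma$-subgaussian random vector $a\in\mathbb R^d$ and every $\varepsilon>0$. Put $m_\varepsilon=\sum_{i=1}^d\mathbf 1_{\sigma_i>\varepsilon\sigma_1}$ and $$\mathcal H_\varepsilon=\sum_{i=1}^{m_\varepsilon}\ln\Big(\frac{\sigma_i}{\varepsilon\sigma_1}\Big)+c\Big[\ln d+\sqrt{\ln(\varepsilon^{-1})\,\ln(d)\,m_\varepsilon}\Big]$$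 (the square root being $0$ when $m_\varepsilon=0$, in particular when $\varepsilon\ge1$). (i) There is a finite set $\mathcal N_\varepsilon\subset\mathcal B$ such that for all $x\in\mathcal B$ there is $y\in\mathcal N_\varepsilon$ with $$\|x-y\|_\Sigma^2:=(x-y)^\top\Sigma(x-y)\le\varepsilon^2\sigma_1^2,\qquad\text{and}\qquad \ln|\mathcal N_\varepsilon|\le\mathcal H_\varepsilon .$$ (ii) For every integer $r\ge1$, if $\varepsilon\le 1$ then $$\mathcal H_\varepsilon\le\ln(\varepsilon^{-1})+\frac{\min\Big(d-1,\ \varepsilon^{-2/r}\frac{d_{\rm eff}(r)-1}{e}\Big)}{2/r}\,\ln\Big(\max\Big(e,\ \varepsilon^{-2/r}\frac{d_{\rm eff}(r)-1}{d-1}\Big)\Big)+c\Big[\ln d+\sqrt{\ln(\varepsilon^{-1})\,\ln(d)\,m_\varepsilon}\Big].$$ (iii) For every integer $r\ge1$ (and every $\varepsilon>0$), $m_\varepsilon\le1+(d_{\rm eff}(r)-1)\,\varepsilon^{-2/r}$. -/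

import Mathlib

open MeasureTheory

noncomputable section

/-- The quadratic form `xᵀ S x`, i.e. the square of the `S`-norm of `x`. -/
def matrixNormSq {d : ℕ} (S : Matrix (Fin d) (Fin d) ℝ) (x : EuclideanSpace ℝ (Fin d)) : ℝ :=
  x.ofLp ⬝ᵥ S.mulVec x.ofLp

/-- A random vector `a` is `S`-subgaussian if `P(|aᵀx| > t) ≤ 2 exp(-t² / (2 xᵀSx))` for all
`t > 0` and all `x` in the closed unit ball. (At `x = 0` the inequality holds trivially.) -/
def IsMatrixSubgaussian {d : ℕ} {Ω : Type*} [MeasurableSpace Ω] (P : Measure Ω)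
    (S : Matrix (Fin d) (Fin d) ℝ) (a : Ω → EuclideanSpace ℝ (Fin d)) : Prop :=
  ∀ t : ℝ, 0 < t → ∀ x ∈ Metric.closedBall (0 : EuclideanSpace ℝ (Fin d)) 1,
    P.real {ω | t < |(a ω).ofLp ⬝ᵥ x.ofLp|} ≤
      2 * Real.exp (-(1 / 2) * (t ^ 2 / matrixNormSq S x))

/-- The numbers `σ₁ ≥ σ₂ ≥ ⋯ ≥ σ_d`, whose squares are the eigenvalues of the positive
semidefinite matrix `S`, repeated with multiplicity, in nonincreasing order.
The index set `Fin d` starts at `0`: `specScale hS 0` is `σ₁`. -/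
def specScale {d : ℕ} {S : Matrix (Fin d) (Fin d) ℝ} (hS : S.PosSemidef) (i : Fin d) : ℝ :=
  Real.sqrt (hS.isHermitian.eigenvalues₀ (Fin.cast (Fintype.card_fin d).symm i))

/-- The effective dimension `d_eff(r) = ∑ᵢ (σᵢ / σ₁)^(2/r)`. -/
def effDim {d : ℕ} [NeZero d] {S : Matrix (Fin d) (Fin d) ℝ} (hS : S.PosSemidef) (r : ℕ) : ℝ :=
  ∑ i : Fin d, (specScale hS i / specScale hS 0) ^ ((2 : ℝ) / (r : ℝ))

/-- `m_ε`, the number of indices `i` with `σᵢ > ε σ₁`. -/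
def largeCount {d : ℕ} [NeZero d] {S : Matrix (Fin d) (Fin d) ℝ} (hS : S.PosSemidef)
    (ε : ℝ) : ℕ :=
  Nat.card {i : Fin d // ε * specScale hS 0 < specScale hS i}

/-- The remainder term `c [ln d + √(ln(ε⁻¹) ln(d) m_ε)]`. -/
def entropyRemainder {d : ℕ} [NeZero d] {S : Matrix (Fin d) (Fin d) ℝ} (hS : S.PosSemidef)
    (c ε : ℝ) : ℝ :=
  c * (Real.log d + Real.sqrt (Real.log ε⁻¹ * Real.log d * (largeCount hS ε : ℝ)))

/-- `H_ε = ∑_{i ≤ m_ε} ln(σᵢ / (ε σ₁)) + c [ln d + √(ln(ε⁻¹) ln(d) m_ε)]`;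
the sum runs over the first `m_ε` indices. -/
def entropyBound {d : ℕ} [NeZero d] {S : Matrix (Fin d) (Fin d) ℝ} (hS : S.PosSemidef)
    (c ε : ℝ) : ℝ :=
  (∑ i ∈ Finset.univ.filter (fun i : Fin d => i.val < largeCount hS ε),
      Real.log (specScale hS i / (ε * specScale hS 0))) + entropyRemainder hS c ε

end

/-! In an eigenbasis of `S`, after division by σ₁, part (i) asks for a cover at accuracy ε of an
ellipsoid with semi-axes τᵢ = σᵢ/σ₁ ≤ 1. The sharp leading term forbids losing a constant factor per
dimension, as a plain volumetric net does; only polynomial factors in d per block of axes are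
affordable.

Balls are therefore covered almost optimally in `exists_cover_unitBall`. A center drawn uniformly
from the ball of radius √(1-δ'²), with δ' slightly below δ, lies within δ' of any given point of the
unit ball with probability at least δ^n up to a polynomial factor (`measureReal_lens_ge`). Greedy
selection (`exists_greedy_cover`) turns this into a cover, again at polynomial cost.

For the ellipsoid, semi-axes are rounded up to geometric levels ε·exp(hk), and axes of one level
form a block. If ρⱼ is the norm of x on block j, then ∑ρⱼ² ≤ 1, so block errors proportional to ρⱼ
add up to the right total; `exists_cover_dilated_balls` provides them for all ρⱼ at once. Each long
axis loses at most h and each block O(ln d); balancing the two gives the square root term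
(`exists_cover_ellipsoid`). Projection onto the convex image then moves the centers into the unit
ball (`exists_internal_cover`).

Part (ii) is a tangent-line bound for the logarithm (`sum_log_div_le`), part (iii) a Markov-type
count (`card_filter_lt_le`). -/

/-! ### Greedy covering from a probability bound. -/

/-- A probabilistic selection step: if every member of a finite family of events has probability
at least `p`, then some outcome lies in a proportion at least `p` of them. -/
theorem exists_mem_many_events {X Y : Type*} [MeasurableSpace Y] (ν : Measure Y)
    [IsProbabilityMeasure ν] (T : Finset X) (A : X → Set Y) (hA : ∀ x, MeasurableSet (A x))
    (p : ℝ) (hp : ∀ x ∈ T, p ≤ ν.real (A x)) [∀ y, DecidablePred fun x => y ∈ A x] :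
    ∃ y, p * T.card ≤ ((T.filter fun x => y ∈ A x).card : ℝ) := by
  have hint : ∀ x ∈ T, Integrable ((A x).indicator fun _ => (1 : ℝ)) ν := fun x _ =>
    (integrable_const 1).indicator (hA x)
  obtain ⟨y, hy⟩ := exists_integral_le (μ := ν) (integrable_finsetSum T hint)
  refine ⟨y, ?_⟩
  have h1 : ∫ a, ∑ x ∈ T, (A x).indicator (fun _ => (1 : ℝ)) a ∂ν = ∑ x ∈ T, ν.real (A x) := by
    rw [integral_finsetSum T hint]
    exact Finset.sum_congr rfl fun x _ => by
      rw [integral_indicator (hA x)]; simp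
  have h2 : ∑ x ∈ T, (A x).indicator (fun _ => (1 : ℝ)) y
      = ((T.filter fun x => y ∈ A x).card : ℝ) := by
    rw [Finset.card_filter]
    push_cast
    exact Finset.sum_congr rfl fun x _ => by simp [Set.indicator_apply]
  rw [h1, h2] at hy
  refine le_trans ?_ hy
  have := Finset.card_nsmul_le_sum T (fun x => ν.real (A x)) p hp
  rw [nsmul_eq_mul] at this
  linarith

/-- Each round picks an outcome that catches a proportion `p` of the points still uncovered. -/
theorem exists_greedy_partial_cover {X Y : Type*} [MeasurableSpace Y] (ν : Measure Y)
    [IsProbabilityMeasure ν] (S : Finset X) (A : X → Set Y) (hA : ∀ x, MeasurableSet (A x))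
    (p : ℝ) (hp1 : p ≤ 1) (hp : ∀ x ∈ S, p ≤ ν.real (A x)) (k : ℕ) :
    ∃ (N : Finset Y) (U : Finset X), U ⊆ S ∧ N.card ≤ k ∧
      (∀ x ∈ S, x ∉ U → ∃ y ∈ N, y ∈ A x) ∧ (U.card : ℝ) ≤ (1 - p) ^ k * S.card := by
  classical
  induction k with
  | zero => exact ⟨∅, S, subset_rfl, by simp, fun x hx h => absurd hx h, by simp⟩
  | succ k ih =>
    obtain ⟨N, U, hUS, hN, hcov, hcard⟩ := ih
    obtain ⟨y, hy⟩ := exists_mem_many_events ν U A hA p fun x hx => hp x (hUS hx)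
    refine ⟨insert y N, U.filter fun x => y ∉ A x, (Finset.filter_subset _ _).trans hUS,
      (Finset.card_insert_le _ _).trans (by omega), fun x hx hxU => ?_, ?_⟩
    · by_cases h : x ∈ U
      · have : y ∈ A x := by
          by_contra h'
          exact hxU (Finset.mem_filter.2 ⟨h, h'⟩)
        exact ⟨y, Finset.mem_insert_self _ _, this⟩
      · obtain ⟨z, hz, hz'⟩ := hcov x hx h
        exact ⟨z, Finset.mem_insert_of_mem hz, hz'⟩
    · have h3 := Finset.card_filter_add_card_filter_not (s := U) (fun x => y ∈ A x)
      have h3' : ((U.filter fun x => y ∈ A x).card : ℝ) + ((U.filter fun x => y ∉ A x).card : ℝ)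
          = U.card := by exact_mod_cast h3
      calc ((U.filter fun x => y ∉ A x).card : ℝ) ≤ (1 - p) * U.card := by linarith
        _ ≤ (1 - p) * ((1 - p) ^ k * S.card) :=
          mul_le_mul_of_nonneg_left hcard (by linarith)
        _ = _ := by ring

/-- After ⌈M/p⌉ rounds at most exp(-M)·|S| ≤ 1/p points remain, and each of them receives an outcome
of its own. -/
theorem exists_greedy_cover {X Y : Type*} [MeasurableSpace Y] (ν : Measure Y)
    [IsProbabilityMeasure ν] (S : Finset X) (A : X → Set Y) (hA : ∀ x, MeasurableSet (A x))
    (p M : ℝ) (hp0 : 0 < p) (hp1 : p ≤ 1) (hp : ∀ x ∈ S, p ≤ ν.real (A x))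
    (hM0 : 0 ≤ M) (hM : p * S.card ≤ Real.exp M) :
    ∃ N : Finset Y, (∀ x ∈ S, ∃ y ∈ N, y ∈ A x) ∧ (N.card : ℝ) ≤ (M + 1) / p + 1 := by
  classical
  obtain ⟨N, U, hUS, hN, hcov, hcard⟩ :=
    exists_greedy_partial_cover ν S A hA p hp1 hp ⌈M / p⌉₊
  have hne : ∀ x ∈ S, ∃ y, y ∈ A x := fun x hx => by
    by_contra! h
    have : A x = ∅ := Set.eq_empty_of_forall_notMem h
    have h2 := hp x hx
    rw [this, measureReal_empty] at h2
    linarith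
  have : Nonempty Y := nonempty_of_isProbabilityMeasure ν
  choose! f hf using hne
  refine ⟨N ∪ U.image f, fun x hx => ?_, ?_⟩
  · by_cases h : x ∈ U
    · exact ⟨f x, Finset.mem_union_right _ (Finset.mem_image_of_mem f h), hf x hx⟩
    · obtain ⟨y, hy, hy'⟩ := hcov x hx h
      exact ⟨y, Finset.mem_union_left _ hy, hy'⟩
  · have hk : M / p ≤ ⌈M / p⌉₊ := Nat.le_ceil _
    have hk' : (⌈M / p⌉₊ : ℝ) < M / p + 1 := Nat.ceil_lt_add_one (by positivity)
    have h1 : (1 - p) ^ ⌈M / p⌉₊ ≤ Real.exp (-M) := by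
      calc (1 - p) ^ ⌈M / p⌉₊ ≤ Real.exp (-p) ^ ⌈M / p⌉₊ :=
            pow_le_pow_left₀ (by linarith) (by linarith [Real.add_one_le_exp (-p)]) _
        _ = Real.exp (⌈M / p⌉₊ * -p) := (Real.exp_nat_mul _ _).symm
        _ ≤ _ := by
          apply Real.exp_le_exp.2
          rw [div_le_iff₀ hp0] at hk
          linarith
    have h2 : (U.card : ℝ) ≤ 1 / p := by
      refine hcard.trans ?_
      rw [le_div_iff₀ hp0]
      calc (1 - p) ^ ⌈M / p⌉₊ * S.card * p = (1 - p) ^ ⌈M / p⌉₊ * (p * S.card) := by ring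
        _ ≤ Real.exp (-M) * Real.exp M := by
          gcongr
        _ = 1 := by rw [← Real.exp_add]; simp
    have h3 : ((N ∪ U.image f).card : ℝ) ≤ N.card + U.card := by
      exact_mod_cast (Finset.card_union_le _ _).trans (by gcongr; exact Finset.card_image_le)
    have h4 : (N.card : ℝ) ≤ ⌈M / p⌉₊ := by exact_mod_cast hN
    rw [add_div]
    linarith

/-! ### Covering the Euclidean unit ball by small balls. -/

section Ball

variable {E : Type*} [NormedAddCommGroup E] [InnerProductSpace ℝ E] [FiniteDimensional ℝ E]
  [MeasurableSpace E] [BorelSpace E]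

open Module
open scoped Pointwise

/-- Volume comparison: the balls of radius η/2 about the points are disjoint and lie in the ball of
radius 1 + η/2. -/
theorem card_le_of_separated_of_norm_le_one (s : Finset E) {η : ℝ} (hη : 0 < η)
    (hs : ∀ x ∈ s, ‖x‖ ≤ 1) (hsep : ∀ x ∈ s, ∀ y ∈ s, x ≠ y → η < dist x y) :
    (s.card : ℝ) ≤ (1 + 2 / η) ^ finrank ℝ E := by
  let μ : Measure E := Measure.addHaar
  have hd : (s : Set E).PairwiseDisjoint fun x => Metric.ball x (η / 2) := by
    intro x hx y hy hxy
    exact Metric.ball_disjoint_ball (by linarith [hsep x hx y hy hxy])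
  have h1 : ∑ x ∈ s, μ.real (Metric.ball x (η / 2)) ≤ μ.real (Metric.ball (0 : E) (1 + η / 2)) := by
    rw [← measureReal_biUnion_finset hd (fun x _ => measurableSet_ball)]
    refine measureReal_mono (Set.iUnion₂_subset fun x hx => ?_) measure_ball_lt_top.ne
    apply Metric.ball_subset_ball'
    rw [dist_zero_right]
    linarith [hs x hx]
  have hb : ∀ (x : E) (r : ℝ), 0 < r →
      μ.real (Metric.ball x r) = r ^ finrank ℝ E * μ.real (Metric.ball (0 : E) 1) := by
    intro x r hr
    rw [measureReal_def, Measure.addHaar_ball_of_pos μ x hr, ENNReal.toReal_mul,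
      ENNReal.toReal_ofReal (by positivity), measureReal_def]
  have hpos : 0 < μ.real (Metric.ball (0 : E) 1) :=
    ENNReal.toReal_pos (Metric.measure_ball_pos μ 0 one_pos).ne' measure_ball_lt_top.ne
  rw [Finset.sum_congr rfl fun x _ => hb x (η / 2) (by positivity),
    hb 0 (1 + η / 2) (by positivity), Finset.sum_const, nsmul_eq_mul, ← mul_assoc, mul_le_mul_iff_left₀ hpos] at h1
  have h2 : 1 + 2 / η = (1 + η / 2) / (η / 2) := by field_simp; ring
  rw [h2, div_pow, le_div_iff₀ (by positivity)]
  exact h1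

/-- A separated set that is not a net can be enlarged, and the volume bound stops this growth. The
crude cardinality suffices: the net only discretizes the ball for the greedy argument. -/
theorem exists_net_unitBall {η : ℝ} (hη : 0 < η) :
    ∃ s : Finset E, (∀ x ∈ s, ‖x‖ ≤ 1) ∧ (∀ x : E, ‖x‖ ≤ 1 → ∃ y ∈ s, dist x y ≤ η) ∧
      (s.card : ℝ) ≤ (1 + 2 / η) ^ finrank ℝ E := by
  classical
  by_contra! hcon
  have key : ∀ k : ℕ, ∃ s : Finset E, s.card = k ∧ (∀ x ∈ s, ‖x‖ ≤ 1) ∧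
      ∀ x ∈ s, ∀ y ∈ s, x ≠ y → η < dist x y := by
    intro k
    induction k with
    | zero => exact ⟨∅, by simp⟩
    | succ k ih =>
      obtain ⟨s, hk, hs, hsep⟩ := ih
      have hcard := card_le_of_separated_of_norm_le_one s hη hs hsep
      have : ∃ x : E, ‖x‖ ≤ 1 ∧ ∀ y ∈ s, η < dist x y := by
        by_contra! h
        exact absurd hcard (not_le.2 (hcon s hs h))
      obtain ⟨x, hx, hxs⟩ := this
      have hnot : x ∉ s := fun h => by
        have := hxs x h
        rw [dist_self] at this
        linarith
      refine ⟨insert x s, by rw [Finset.card_insert_of_notMem hnot, hk], ?_, ?_⟩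
      · intro y hy
        rcases Finset.mem_insert.1 hy with rfl | hy
        exacts [hx, hs y hy]
      · intro y hy z hz hyz
        rcases Finset.mem_insert.1 hy with rfl | hy' <;>
          rcases Finset.mem_insert.1 hz with rfl | hz'
        · exact absurd rfl hyz
        · exact hxs z hz'
        · rw [dist_comm]; exact hxs y hy'
        · exact hsep y hy' z hz' hyz
  obtain ⟨k, hk⟩ := exists_nat_gt ((1 + 2 / η) ^ finrank ℝ E)
  obtain ⟨s, hs, h1, h2⟩ := key k
  have := card_le_of_separated_of_norm_le_one s hη h1 h2
  rw [hs] at this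
  linarith

/-- A centered ball contains a thin slab on one side of a hyperplane that occupies at least the
fraction `1 / (2 k)` of it. -/
theorem measureReal_closedBall_le_slab (μ : Measure E) [μ.IsAddHaarMeasure] (s : ℝ) (x : E)
    (hs1 : s ≤ 1) (hx : ‖x‖ ≤ 1) (k : ℕ) (hk : 0 < k) :
    μ.real (Metric.closedBall (0 : E) s) ≤
      2 * k * μ.real {w : E | ‖w‖ ≤ s ∧ 0 ≤ inner ℝ x w ∧ k * inner ℝ x w ≤ 1} := by
  set W : Set E := {w : E | ‖w‖ ≤ s ∧ 0 ≤ inner ℝ x w ∧ k * inner ℝ x w ≤ 1} with hW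
  set H : Set E := {w : E | ‖w‖ ≤ s ∧ 0 ≤ inner ℝ x w} with hH
  let L : ℕ → Set E := fun j => {w : E | ‖w‖ ≤ s ∧ (j : ℝ) ≤ k * inner ℝ x w ∧
    k * inner ℝ x w ≤ j + 1}
  have hkr : (0 : ℝ) < k := by exact_mod_cast hk
  have hfin : ∀ A : Set E, A ⊆ Metric.closedBall (0 : E) s → μ A ≠ ⊤ := fun A hA =>
    ((measure_mono hA).trans_lt measure_closedBall_lt_top).ne
  have hsub : ∀ A : Set E, (∀ w ∈ A, ‖w‖ ≤ s) → A ⊆ Metric.closedBall (0 : E) s :=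
    fun A hA w hw => mem_closedBall_zero_iff.2 (hA w hw)
  have hWfin : μ W ≠ ⊤ := hfin _ (hsub _ fun w hw => hw.1)
  have hHfin : μ H ≠ ⊤ := hfin _ (hsub _ fun w hw => hw.1)
  have hL : ∀ j, μ.real (L j) ≤ μ.real W := by
    intro j
    -- Translation by `v` lowers the inner product with `x` by j/k. As that product is at least j/k
    -- on `L j`, the norm does not grow, so `L j` lands in the first slab.
    set v : E := (-((j / k : ℝ) / ‖x‖ ^ 2)) • x with hv
    have hLW : L j ⊆ (fun w => w + v) ⁻¹' W := by
      rintro w ⟨h1, h2, h3⟩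
      by_cases hx0 : x = 0
      · subst hx0
        have hv0 : v = 0 := by simp [hv]
        simp only [Set.mem_preimage, hv0, add_zero, hW, Set.mem_ofPred_eq, inner_zero_left]
        simp [h1]
      · have hxpos : 0 < ‖x‖ ^ 2 := by positivity
        have hin : inner ℝ x (w + v) = inner ℝ x w - j / k := by
          rw [inner_add_right, hv, inner_smul_right, real_inner_self_eq_norm_sq]
          field_simp
          ring
        have hq : (j / k : ℝ) ≤ inner ℝ x w := by
          rw [div_le_iff₀ hkr]; linarith
        refine ⟨?_, ?_, ?_⟩
        · refine le_trans ?_ h1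
          refine (sq_le_sq₀ (norm_nonneg _) (norm_nonneg _)).1 ?_
          rw [norm_add_sq_real, hv, inner_smul_right, norm_smul, real_inner_comm, mul_pow,
            Real.norm_eq_abs, sq_abs]
          have e : (-((j / k : ℝ) / ‖x‖ ^ 2)) ^ 2 * ‖x‖ ^ 2
              = ((j / k : ℝ) / ‖x‖ ^ 2) * (j / k : ℝ) := by
            field_simp
          rw [e]
          have h0 : 0 ≤ (j / k : ℝ) / ‖x‖ ^ 2 := by positivity
          have h00 : (0 : ℝ) ≤ j / k := by positivity
          nlinarith [mul_le_mul_of_nonneg_left hq h0, mul_nonneg h0 h00]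
        · rw [hin]; linarith
        · rw [hin, mul_sub, mul_div_cancel₀ _ hkr.ne']; linarith
    calc μ.real (L j) ≤ μ.real ((fun w => w + v) ⁻¹' W) :=
          measureReal_mono hLW (by rw [measure_preimage_add_right]; exact hWfin)
      _ = μ.real W := by rw [measureReal_def, measure_preimage_add_right, measureReal_def]
  have h1 : μ.real H ≤ k * μ.real W := by
    have hcov : H ⊆ ⋃ j ∈ Finset.range k, L j := by
      rintro w ⟨h1, h2⟩
      have hle : inner ℝ x w ≤ 1 := by
        calc inner ℝ x w ≤ ‖x‖ * ‖w‖ := real_inner_le_norm _ _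
          _ ≤ 1 * 1 := by gcongr; linarith
          _ = 1 := by norm_num
      -- At inner product 1 the floor would be `k`, outside the range; the point belongs to the last
      -- slab.
      by_cases he : inner ℝ x w = 1
      · refine Set.mem_iUnion₂.2 ⟨k - 1, by simp; omega, h1, ?_⟩
        have : ((k - 1 : ℕ) : ℝ) = k - 1 := by rw [Nat.cast_sub (by omega)]; simp
        rw [this, he]
        constructor <;> linarith
      · have hlt : inner ℝ x w < 1 := lt_of_le_of_ne hle he
        refine Set.mem_iUnion₂.2 ⟨⌊k * inner ℝ x w⌋₊, ?_, h1, Nat.floor_le (by positivity),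
          (Nat.lt_floor_add_one _).le⟩
        rw [Finset.mem_range, Nat.floor_lt (by positivity)]
        nlinarith
    calc μ.real H ≤ μ.real (⋃ j ∈ Finset.range k, L j) := by
          refine measureReal_mono hcov (hfin _ ?_)
          exact Set.iUnion₂_subset fun j _ => hsub _ fun w hw => hw.1
      _ ≤ ∑ j ∈ Finset.range k, μ.real (L j) := measureReal_biUnion_finset_le _ _
      _ ≤ ∑ j ∈ Finset.range k, μ.real W := Finset.sum_le_sum fun j _ => hL j
      _ = k * μ.real W := by simp
  have h2 : μ.real (Metric.closedBall (0 : E) s) ≤ μ.real H + μ.real (-H) := by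
    refine (measureReal_mono (s₂ := H ∪ -H) ?_ ?_).trans (measureReal_union_le _ _)
    · intro w hw
      have hw' := mem_closedBall_zero_iff.1 hw
      rcases le_total 0 (inner ℝ x w) with h | h
      · exact Or.inl ⟨hw', h⟩
      · refine Or.inr ⟨by rwa [norm_neg], ?_⟩
        rw [inner_neg_right]; linarith
    · exact hfin _ (Set.union_subset (hsub _ fun w hw => hw.1)
        (hsub _ fun w hw => by simpa using hw.1))
  have h3 : μ.real (-H) = μ.real H := by
    rw [measureReal_def, Measure.measure_neg, measureReal_def]
  rw [h3] at h2
  linarith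

/-- A ball of radius `δ` centered in the unit ball meets the ball of radius `√(1 - δ²)` in a set
whose relative volume is, up to a polynomial factor, at least `δ ^ n`. -/
theorem measureReal_lens_ge (μ : Measure E) [μ.IsAddHaarMeasure] {δ R s : ℝ} (hδ : 0 < δ)
    (hR : 0 < R) (hδR : R ^ 2 + δ ^ 2 = 1) (x : E) (hx : ‖x‖ ≤ 1) (k : ℕ) (hk : 0 < k)
    (hs0 : 0 < s) (hs : k * (1 - s ^ 2) = 2) :
    δ ^ finrank ℝ E * s ^ finrank ℝ E / (2 * k) * μ.real (Metric.closedBall (0 : E) R) ≤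
      μ.real (Metric.closedBall (0 : E) R ∩ Metric.closedBall x δ) := by
  have hkr : (0 : ℝ) < k := by exact_mod_cast hk
  set W : Set E := {w : E | ‖w‖ ≤ s ∧ 0 ≤ inner ℝ x w ∧ k * inner ℝ x w ≤ 1} with hW
  have hs1 : s ≤ 1 := by
    by_contra h
    have : 0 < s ^ 2 - 1 := by nlinarith
    nlinarith [mul_pos hkr this]
  have hslab := measureReal_closedBall_le_slab μ s x hs1 hx k hk
  rw [← hW] at hslab
  have hb : ∀ r : ℝ, 0 < r → μ.real (Metric.closedBall (0 : E) r)
      = r ^ finrank ℝ E * μ.real (Metric.ball (0 : E) 1) := by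
    intro r hr
    rw [measureReal_def, Measure.addHaar_closedBall μ 0 hr.le, ENNReal.toReal_mul,
      ENNReal.toReal_ofReal (by positivity), measureReal_def]
  have hineq : ∀ q n2 : ℝ, 0 ≤ q → k * q ≤ 1 → n2 ≤ s ^ 2 → 2 * q ≤ 1 - n2 := by
    intro q n2 hq hkq hn
    have : k * (2 * q) ≤ k * (1 - s ^ 2) := by linarith
    have := le_of_mul_le_mul_left this hkr
    linarith
  have hx2 : ‖x‖ ^ 2 ≤ 1 := pow_le_one₀ (norm_nonneg _) hx
  -- For ‖x‖ = 1 the two spheres meet orthogonally, in a sphere of radius Rδ about R²x; a copy of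
  -- `W` scaled by Rδ is placed there. The sign of `t` makes the cross term nonpositive for the ball
  -- of larger radius; for the other ball `hineq` absorbs it.
  have hmap : ∃ t : ℝ, |t| = R * δ ∧ ∀ w ∈ W,
      R ^ 2 • x + t • w ∈ Metric.closedBall (0 : E) R ∩ Metric.closedBall x δ := by
    have hnorm : ∀ (α t : ℝ) (w : E), ‖α • x + t • w‖ ^ 2
        = α ^ 2 * ‖x‖ ^ 2 + 2 * α * t * inner ℝ x w + t ^ 2 * ‖w‖ ^ 2 := by
      intro α t w
      rw [norm_add_sq_real, norm_smul, norm_smul, inner_smul_left, inner_smul_right, mul_pow,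
        mul_pow, Real.norm_eq_abs, Real.norm_eq_abs, sq_abs, sq_abs]
      simp
      ring
    have hsub : ∀ (t : ℝ) (w : E), R ^ 2 • x + t • w - x = (-δ ^ 2) • x + t • w := by
      intro t w
      have : -δ ^ 2 = R ^ 2 - 1 := by linarith
      rw [this, sub_smul, one_smul]; abel
    rcases le_total δ R with h | h
    · refine ⟨-(R * δ), by rw [abs_neg, abs_of_pos (by positivity)], fun w hw => ?_⟩
      obtain ⟨h1, h2, h3⟩ := hw
      have hw2 : ‖w‖ ^ 2 ≤ s ^ 2 := by gcongr
      have h4 := hineq _ _ h2 h3 hw2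
      have hw3 : ‖w‖ ^ 2 ≤ 1 := by linarith
      set q := inner ℝ x w
      constructor
      · rw [mem_closedBall_zero_iff]
        refine (sq_le_sq₀ (norm_nonneg _) hR.le).1 ?_
        rw [hnorm]
        have e : R ^ 2 = R ^ 2 * (R ^ 2 * 1 + δ ^ 2 * 1) := by rw [mul_one, mul_one, hδR, mul_one]
        have h5 : 0 ≤ R ^ 3 * δ * q := by positivity
        have h6 : R ^ 2 * (R ^ 2 * ‖x‖ ^ 2 + δ ^ 2 * ‖w‖ ^ 2) ≤ R ^ 2 := by
          conv_rhs => rw [e]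
          gcongr
        linarith
      · rw [Metric.mem_closedBall, dist_eq_norm, hsub]
        refine (sq_le_sq₀ (norm_nonneg _) hδ.le).1 ?_
        rw [hnorm]
        have h5 : 2 * (δ * R) * q ≤ R ^ 2 * (1 - ‖w‖ ^ 2) := by
          calc 2 * (δ * R) * q ≤ 2 * (R * R) * q := by gcongr
            _ = R ^ 2 * (2 * q) := by ring
            _ ≤ _ := by gcongr
        have h6 : δ ^ 2 * (δ ^ 2 * ‖x‖ ^ 2 + 2 * (δ * R) * q + R ^ 2 * ‖w‖ ^ 2) ≤ δ ^ 2 * 1 := by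
          gcongr
          nlinarith [mul_le_mul_of_nonneg_left hx2 (sq_nonneg δ)]
        linarith
    · refine ⟨R * δ, by rw [abs_of_pos (by positivity)], fun w hw => ?_⟩
      obtain ⟨h1, h2, h3⟩ := hw
      have hw2 : ‖w‖ ^ 2 ≤ s ^ 2 := by gcongr
      have h4 := hineq _ _ h2 h3 hw2
      have hw3 : ‖w‖ ^ 2 ≤ 1 := by linarith
      set q := inner ℝ x w
      constructor
      · rw [mem_closedBall_zero_iff]
        refine (sq_le_sq₀ (norm_nonneg _) hR.le).1 ?_
        rw [hnorm]
        have h5 : 2 * (R * δ) * q ≤ δ ^ 2 * (1 - ‖w‖ ^ 2) := by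
          calc 2 * (R * δ) * q ≤ 2 * (δ * δ) * q := by gcongr
            _ = δ ^ 2 * (2 * q) := by ring
            _ ≤ _ := by gcongr
        have h6 : R ^ 2 * (R ^ 2 * ‖x‖ ^ 2 + 2 * (R * δ) * q + δ ^ 2 * ‖w‖ ^ 2) ≤ R ^ 2 * 1 := by
          gcongr
          nlinarith [mul_le_mul_of_nonneg_left hx2 (sq_nonneg R)]
        linarith
      · rw [Metric.mem_closedBall, dist_eq_norm, hsub]
        refine (sq_le_sq₀ (norm_nonneg _) hδ.le).1 ?_
        rw [hnorm]
        have e : δ ^ 2 = δ ^ 2 * (δ ^ 2 * 1 + R ^ 2 * 1) := by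
          rw [mul_one, mul_one, add_comm, hδR, mul_one]
        have h5 : 0 ≤ δ ^ 3 * R * q := by positivity
        have h6 : δ ^ 2 * (δ ^ 2 * ‖x‖ ^ 2 + R ^ 2 * ‖w‖ ^ 2) ≤ δ ^ 2 := by
          conv_rhs => rw [e]
          gcongr
        linarith
  obtain ⟨t, ht, hmem⟩ := hmap
  set A := Metric.closedBall (0 : E) R ∩ Metric.closedBall x δ with hA
  have hAfin : μ A ≠ ⊤ :=
    ((measure_mono Set.inter_subset_left).trans_lt measure_closedBall_lt_top).ne
  have hvol : (R * δ) ^ finrank ℝ E * μ.real W ≤ μ.real A := by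
    have hsub : t • W ⊆ (fun y => R ^ 2 • x + y) ⁻¹' A := by
      rintro _ ⟨w, hw, rfl⟩
      exact hmem w hw
    have h1 : μ (t • W) ≤ μ A := by
      rw [← measure_preimage_add μ (R ^ 2 • x) A]
      exact measure_mono hsub
    rw [Measure.addHaar_smul, abs_pow, ht] at h1
    have h2 := ENNReal.toReal_mono hAfin h1
    rwa [ENNReal.toReal_mul, ENNReal.toReal_ofReal (by positivity)] at h2
  refine le_trans ?_ hvol
  rw [hb s hs0] at hslab
  rw [hb R hR]
  calc δ ^ finrank ℝ E * s ^ finrank ℝ E / (2 * k) *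
        (R ^ finrank ℝ E * μ.real (Metric.ball (0 : E) 1))
      = (R * δ) ^ finrank ℝ E *
        ((s ^ finrank ℝ E * μ.real (Metric.ball (0 : E) 1)) / (2 * k)) := by
        rw [mul_pow]; ring
    _ ≤ (R * δ) ^ finrank ℝ E * μ.real W := by
        gcongr
        rw [div_le_iff₀ (by positivity)]
        linarith

/-- The unit ball of dimension `n` is covered by `poly(n) / δ ^ n` balls of radius `δ`. -/
theorem exists_cover_unitBall {δ : ℝ} (hδ : 0 < δ) (hδ1 : δ < 1) (d : ℕ) (hd : 2 ≤ d)
    (hn : finrank ℝ E ≤ d) :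
    ∃ N : Finset E, (∀ x : E, ‖x‖ ≤ 1 → ∃ y ∈ N, dist x y ≤ δ) ∧
      (N.card : ℝ) ≤ (d : ℝ) ^ 12 * (1 / δ) ^ finrank ℝ E := by
  let μ : Measure E := Measure.addHaar
  set n := finrank ℝ E with hn_def
  have hnr : (0 : ℝ) ≤ n := n.cast_nonneg
  -- The net mesh δ/(n+2) and the radius δq add up to δ, while q^n ≥ 1/3 costs only a constant.
  set q : ℝ := (n + 1) / (n + 2) with hq
  have hq0 : 0 < q := by positivity
  have hq1 : q < 1 := by rw [hq, div_lt_one (by positivity)]; linarith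
  obtain ⟨X, hX1, hX2, hX3⟩ := exists_net_unitBall (E := E) (η := δ / (n + 2)) (by positivity)
  set δ' := δ * q with hδ'
  have hδ'0 : 0 < δ' := by positivity
  have hδ'1 : δ' < 1 := by nlinarith
  set R := Real.sqrt (1 - δ' ^ 2) with hR
  have hRpos : 0 < 1 - δ' ^ 2 := by nlinarith
  have hR0 : 0 < R := Real.sqrt_pos.2 hRpos
  have hRδ : R ^ 2 + δ' ^ 2 = 1 := by rw [hR, Real.sq_sqrt hRpos.le]; ring
  set s := Real.sqrt q with hs
  have hs0 : 0 < s := Real.sqrt_pos.2 hq0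
  have hs2 : s ^ 2 = q := Real.sq_sqrt hq0.le
  have hqs : q ≤ s := by
    have : s ≤ 1 := Real.sqrt_le_one.2 hq1.le
    nlinarith
  have hB0 : μ (Metric.closedBall (0 : E) R) ≠ 0 := (Metric.measure_closedBall_pos μ 0 hR0).ne'
  have hBtop : μ (Metric.closedBall (0 : E) R) ≠ ⊤ := measure_closedBall_lt_top.ne
  let ν : Measure E := ProbabilityTheory.cond μ (Metric.closedBall (0 : E) R)
  have : IsProbabilityMeasure ν := ProbabilityTheory.cond_isProbabilityMeasure_of_finite hB0 hBtop
  have hqn : 1 / 3 ≤ q ^ n := by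
    have h1 : (1 / q) ^ n ≤ 3 := by
      have h2 : 1 / q ≤ Real.exp (1 / (n + 1)) := by
        have := Real.add_one_le_exp (1 / ((n : ℝ) + 1))
        refine le_trans (le_of_eq ?_) this
        rw [hq]; field_simp; ring
      calc (1 / q) ^ n ≤ Real.exp (1 / (n + 1)) ^ n := by gcongr
        _ = Real.exp (n * (1 / (n + 1))) := (Real.exp_nat_mul _ _).symm
        _ ≤ Real.exp 1 := by
          apply Real.exp_le_exp.2
          rw [mul_one_div, div_le_one (by positivity)]; linarith
        _ ≤ 3 := by linarith [Real.exp_one_lt_d9]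
    rw [one_div, inv_pow] at h1
    rw [one_div]
    exact inv_le_of_inv_le₀ (by positivity) h1
  -- 36(n+2) = 9 · 2k with k = 2(n+2); the 9 pays for q^n and s^n, each at least 1/3.
  set p : ℝ := δ ^ n / (36 * (n + 2)) with hp
  have hp0 : 0 < p := by positivity
  have hδn : δ ^ n ≤ 1 := pow_le_one₀ hδ.le hδ1.le
  have hp1 : p ≤ 1 := by
    rw [hp, div_le_one (by positivity)]; linarith
  have hprob : ∀ x ∈ X, p ≤ ν.real (Metric.closedBall x δ') := by
    intro x hx
    have hlens := measureReal_lens_ge μ hδ'0 hR0 hRδ x (hX1 x hx) (2 * (n + 2)) (by positivity)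
      hs0 (by rw [hs2, hq]; push_cast; field_simp; ring)
    have hBpos : 0 < μ.real (Metric.closedBall (0 : E) R) := ENNReal.toReal_pos hB0 hBtop
    rw [measureReal_def, ProbabilityTheory.cond_apply measurableSet_closedBall, ENNReal.toReal_mul,
      ENNReal.toReal_inv, ← measureReal_def, ← measureReal_def, inv_mul_eq_div, le_div_iff₀ hBpos]
    refine le_trans ?_ hlens
    gcongr
    rw [← hn_def, hp, hδ', mul_pow, div_le_div_iff₀ (by positivity) (by positivity)]
    push_cast
    have h9 : 1 / 9 ≤ q ^ n * s ^ n := by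
      calc (1 : ℝ) / 9 = 1 / 3 * (1 / 3) := by norm_num
        _ ≤ q ^ n * q ^ n := by gcongr
        _ ≤ _ := by gcongr
    have h10 : 0 ≤ δ ^ n * (n + 2) := by positivity
    nlinarith [mul_le_mul_of_nonneg_left h9 h10]
  -- The δ^(-n) in the size of the net cancels against `p`, so the greedy parameter M is polynomial
  -- in n and free of δ.
  have hM : p * X.card ≤ Real.exp (n * (2 * n + 5)) := by
    have h1 : 1 + 2 / (δ / (n + 2)) ≤ (2 * n + 5) / δ := by
      rw [div_div_eq_mul_div, ← sub_nonneg]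
      have : (2 * n + 5) / δ - (1 + 2 * (n + 2) / δ) = (1 - δ) / δ := by field_simp; ring
      rw [this]
      apply div_nonneg <;> linarith
    calc p * X.card ≤ δ ^ n * ((2 * n + 5) / δ) ^ n := by
          gcongr
          · rw [hp]; apply div_le_self (by positivity); linarith
          · exact hX3.trans (by gcongr)
      _ = (2 * n + 5) ^ n := by rw [← mul_pow, mul_div_cancel₀ _ hδ.ne']
      _ ≤ Real.exp (2 * n + 5) ^ n := by
          gcongr
          linarith [Real.add_one_le_exp (2 * (n : ℝ) + 5)]
      _ = _ := (Real.exp_nat_mul _ _).symm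
  obtain ⟨N, hN1, hN2⟩ := exists_greedy_cover ν X (fun x => Metric.closedBall x δ')
    (fun x => measurableSet_closedBall) p (n * (2 * n + 5)) hp0 hp1 hprob (by positivity) hM
  refine ⟨N, fun x hx => ?_, ?_⟩
  · obtain ⟨y, hy, hxy⟩ := hX2 x hx
    obtain ⟨z, hz, hyz⟩ := hN1 y hy
    refine ⟨z, hz, ?_⟩
    rw [Metric.mem_closedBall'] at hyz
    have e : δ / (n + 2) + δ' = δ := by rw [hδ', hq]; field_simp; ring
    linarith [dist_triangle x y z]
  · refine hN2.trans ?_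
    have hdr : (2 : ℝ) ≤ d := by exact_mod_cast hd
    have hnd : (n : ℝ) ≤ d := by exact_mod_cast hn
    have hinv : 1 ≤ (1 / δ) ^ n := one_le_pow₀ (by rw [le_div_iff₀ hδ]; linarith)
    have e : (n * (2 * n + 5) + 1 : ℝ) / p
        = (n * (2 * n + 5) + 1) * (36 * (n + 2)) * (1 / δ) ^ n := by
      rw [hp, one_div, inv_pow]; field_simp
    rw [e]
    have h1 : (n * (2 * n + 5) + 1 : ℝ) ≤ 5 * d ^ 2 := by
      calc (n * (2 * n + 5) + 1 : ℝ) ≤ d * (2 * d + 5) + 1 := by gcongr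
        _ ≤ 5 * d ^ 2 := by nlinarith
    have h2 : (36 * (n + 2) : ℝ) ≤ 72 * d := by linarith
    have h3 : (n * (2 * n + 5) + 1 : ℝ) * (36 * (n + 2)) ≤ 360 * d ^ 3 := by
      calc (n * (2 * n + 5) + 1 : ℝ) * (36 * (n + 2)) ≤ 5 * d ^ 2 * (72 * d) := by gcongr
        _ = _ := by ring
    have h4 : (360 * d ^ 3 + 1 : ℝ) ≤ d ^ 12 := by
      have h5 : (2 : ℝ) ^ 9 ≤ d ^ 9 := by gcongr
      have h6 : (2 : ℝ) ^ 3 ≤ d ^ 3 := by gcongr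
      calc (360 * d ^ 3 + 1 : ℝ) ≤ 2 ^ 9 * d ^ 3 := by norm_num at h6 ⊢; linarith
        _ ≤ d ^ 9 * d ^ 3 := by gcongr
        _ = _ := by ring
    calc (n * (2 * n + 5) + 1 : ℝ) * (36 * (n + 2)) * (1 / δ) ^ n + 1
        ≤ 360 * d ^ 3 * (1 / δ) ^ n + 1 * (1 / δ) ^ n := by gcongr; linarith
      _ = (360 * d ^ 3 + 1) * (1 / δ) ^ n := by ring
      _ ≤ _ := by gcongr

end Ball

/-! ### From balls to ellipsoids. -/

open Module in
/-- A single finite set that covers every dilate `b ρ` of the unit ball, `0 ≤ ρ ≤ 1`, with the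
accuracy `ρ e` up to a discretization of `ρ ^ 2` at scale `1 / D`. -/
theorem exists_cover_dilated_balls {E : Type*} [NormedAddCommGroup E] [InnerProductSpace ℝ E]
    [FiniteDimensional ℝ E] [MeasurableSpace E] [BorelSpace E] {e b : ℝ} (he : 0 < e) (hb : e < b)
    (d : ℕ) (hd : 2 ≤ d) (hn : finrank ℝ E ≤ d) (D : ℕ) (hD : 0 < D) :
    ∃ G : Finset E, (∀ (z : E) (ρ : ℝ), 0 ≤ ρ → ρ ≤ 1 → ‖z‖ ≤ b * ρ →
        ∃ y ∈ G, ‖z - y‖ ^ 2 ≤ (ρ ^ 2 + 1 / D) * e ^ 2) ∧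
      (G.card : ℝ) ≤ (D + 1) * d ^ 12 * (b / e) ^ finrank ℝ E := by
  classical
  have hb0 : 0 < b := he.trans hb
  have hDr : (0 : ℝ) < D := by exact_mod_cast hD
  obtain ⟨N, hN, hcard⟩ := exists_cover_unitBall (E := E) (δ := e / b) (by positivity)
    ((div_lt_one hb0).2 hb) d hd hn
  refine ⟨(Finset.range (D + 1) ×ˢ N).image fun q => (b * Real.sqrt (q.1 / D)) • q.2, ?_, ?_⟩
  · intro z ρ hρ0 hρ1 hz
    -- Rounding ρ² rather than ρ keeps the loss additive in the sum of squared errors over blocks.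
    set k := ⌈D * ρ ^ 2⌉₊ with hk
    have hk1 : D * ρ ^ 2 ≤ k := Nat.le_ceil _
    have hk2 : (k : ℝ) < D * ρ ^ 2 + 1 := Nat.ceil_lt_add_one (by positivity)
    have hkD : k ≤ D := by
      rw [hk, Nat.ceil_le]
      have : ρ ^ 2 ≤ 1 := pow_le_one₀ hρ0 hρ1
      nlinarith
    set r := Real.sqrt (k / D) with hr
    have hr2 : r ^ 2 = k / D := Real.sq_sqrt (by positivity)
    have hρr : ρ ≤ r := Real.le_sqrt_of_sq_le (by rw [le_div_iff₀ hDr]; linarith)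
    have hr2' : r ^ 2 ≤ ρ ^ 2 + 1 / D := by
      rw [hr2, div_le_iff₀ hDr, add_mul, one_div, inv_mul_cancel₀ hDr.ne']
      linarith
    have hr0 : 0 ≤ r := Real.sqrt_nonneg _
    obtain ⟨y, hy, hxy⟩ := hN ((b * r)⁻¹ • z) (by
      rw [norm_smul, Real.norm_of_nonneg (by positivity), inv_mul_eq_div]
      exact div_le_one_of_le₀ (hz.trans (by gcongr)) (by positivity))
    refine ⟨(b * r) • y, Finset.mem_image.2 ⟨(k, y), ?_, rfl⟩, ?_⟩
    · exact Finset.mem_product.2 ⟨Finset.mem_range.2 (by dsimp only; omega), hy⟩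
    · refine le_trans ?_ (mul_le_mul_of_nonneg_right hr2' (sq_nonneg e))
      rw [← mul_pow]
      refine pow_le_pow_left₀ (norm_nonneg _) ?_ 2
      rcases hr0.eq_or_lt with h0 | h0
      · have hz0 : z = 0 := by
          rw [← h0] at hρr
          have : ρ = 0 := le_antisymm hρr hρ0
          rw [this, mul_zero] at hz
          exact norm_le_zero_iff.1 hz
        simp [hz0, ← h0]
      · have hbr : 0 < b * r := by positivity
        have : z - (b * r) • y = (b * r) • ((b * r)⁻¹ • z - y) := by
          rw [smul_sub, smul_inv_smul₀ hbr.ne']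
        rw [this, norm_smul, Real.norm_of_nonneg hbr.le, ← dist_eq_norm]
        calc b * r * dist ((b * r)⁻¹ • z) y ≤ b * r * (e / b) := by gcongr
          _ = r * e := by field_simp
  · have h1 : (((Finset.range (D + 1) ×ˢ N).image
        fun q => (b * Real.sqrt (q.1 / D)) • q.2).card : ℝ) ≤ (D + 1) * N.card := by
      have := Finset.card_image_le (s := Finset.range (D + 1) ×ˢ N)
        (f := fun q => (b * Real.sqrt (q.1 / D)) • q.2)
      rw [Finset.card_product, Finset.card_range] at this
      exact_mod_cast this
    refine h1.trans ?_
    rw [one_div_div] at hcard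
    rw [mul_assoc]
    gcongr

/-- Covering an ellipsoid with semi-axes `τ`, each dominated by the radius of its block, by the
product of coverings of the blocks. -/
theorem exists_cover_ellipsoid_of_blocks {ι κ : Type*} [Fintype ι] [Fintype κ] (blk : ι → κ)
    (hblk : Function.Surjective blk) (b : κ → ℝ) (τ : ι → ℝ) {ε : ℝ} (hε : 0 < ε)
    (hτ0 : ∀ i, 0 ≤ τ i) (hτ : ∀ i, τ i ≤ b (blk i)) (hb : ∀ j, ε ≤ b j)
    (hd : 2 ≤ Fintype.card ι) :
    ∃ C : Finset (EuclideanSpace ℝ ι),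
      (∀ x : EuclideanSpace ℝ ι, ‖x‖ ≤ 1 → ∃ c ∈ C, ∑ i, (τ i * x i - c i) ^ 2 ≤ ε ^ 2) ∧
      (C.card : ℝ) ≤
        ((Fintype.card ι : ℝ) ^ 16) ^ Fintype.card κ * (Real.exp 1 * ∏ i, (b (blk i) / ε)) := by
  classical
  set d := Fintype.card ι with hd_def
  have hdr : (2 : ℝ) ≤ d := by exact_mod_cast hd
  -- Shrinking the accuracy by `a` pays for the discretization: at most d blocks at scale 1/d² add
  -- 1/d in total. The price is a^d ≤ exp 1. It also makes `e` strictly smaller than every block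
  -- radius, even one equal to ε.
  set a : ℝ := Real.sqrt (1 + 1 / d) with ha
  have ha2 : a ^ 2 = 1 + 1 / d := Real.sq_sqrt (by positivity)
  have ha1 : 1 < a := by
    rw [ha, Real.lt_sqrt zero_le_one]
    have : (0 : ℝ) < 1 / d := by positivity
    linarith
  have ha0 : 0 < a := by linarith
  set e := ε / a with he
  have he0 : 0 < e := by positivity
  have heε : e < ε := div_lt_self hε ha1
  have hfr : ∀ j, Module.finrank ℝ (EuclideanSpace ℝ {i // blk i = j})
      = Fintype.card {i // blk i = j} := fun j => finrank_euclideanSpace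
  have hex := fun j => exists_cover_dilated_balls (E := EuclideanSpace ℝ {i // blk i = j}) he0
    (heε.trans_le (hb j)) d hd (by rw [hfr]; exact Fintype.card_subtype_le _) (d ^ 2)
    (by positivity)
  choose G hG hGcard using hex
  refine ⟨(Fintype.piFinset G).image fun g => WithLp.toLp 2 fun i => g (blk i) ⟨i, rfl⟩, ?_, ?_⟩
  · intro x hx
    let ρ : κ → ℝ := fun j => Real.sqrt (∑ i : {i // blk i = j}, x i ^ 2)
    have hρ2 : ∀ j, ρ j ^ 2 = ∑ i : {i // blk i = j}, x i ^ 2 := fun j =>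
      Real.sq_sqrt (Finset.sum_nonneg fun i _ => sq_nonneg _)
    have hfib : ∀ f : ι → ℝ, ∑ j, ∑ i : {i // blk i = j}, f i = ∑ i, f i := fun f =>
      Fintype.sum_fiberwise blk f
    have hsum : ∑ j, ρ j ^ 2 ≤ 1 := by
      simp_rw [hρ2]
      rw [hfib fun i => x i ^ 2, ← EuclideanSpace.real_norm_sq_eq]
      exact pow_le_one₀ (norm_nonneg _) hx
    have hρ0 : ∀ j, 0 ≤ ρ j := fun j => Real.sqrt_nonneg _
    have hρ1 : ∀ j, ρ j ≤ 1 := fun j => by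
      have h1 := Finset.single_le_sum (f := fun j => ρ j ^ 2) (fun j _ => sq_nonneg _)
        (Finset.mem_univ j)
      have h2 : ρ j ^ 2 ≤ 1 := h1.trans hsum
      exact (sq_le_one_iff₀ (hρ0 j)).1 h2
    let z : ∀ j, EuclideanSpace ℝ {i // blk i = j} := fun j => WithLp.toLp 2 fun i => τ i * x i
    have hz : ∀ j, ‖z j‖ ≤ b j * ρ j := fun j => by
      have hbj : 0 ≤ b j := hε.le.trans (hb j)
      refine (sq_le_sq₀ (norm_nonneg _) (mul_nonneg hbj (hρ0 j))).1 ?_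
      rw [EuclideanSpace.real_norm_sq_eq, mul_pow, hρ2, Finset.mul_sum]
      refine Finset.sum_le_sum fun i _ => ?_
      change (τ i * x i) ^ 2 ≤ _
      rw [mul_pow]
      have h1 : τ i ≤ b j := by
        have := hτ i
        rwa [i.2] at this
      have := hτ0 i
      gcongr
    choose y hyG hy using fun j => hG j (z j) (ρ j) (hρ0 j) (hρ1 j) (hz j)
    refine ⟨_, Finset.mem_image.2 ⟨y, Fintype.mem_piFinset.2 hyG, rfl⟩, ?_⟩
    rw [← hfib]
    have hterm : ∀ j, ∑ i : {i // blk i = j},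
        (τ i * x i - (WithLp.toLp 2 fun i => y (blk i) ⟨i, rfl⟩ : EuclideanSpace ℝ ι) i) ^ 2
        = ‖z j - y j‖ ^ 2 := fun j => by
      rw [EuclideanSpace.real_norm_sq_eq]
      refine Finset.sum_congr rfl ?_
      rintro ⟨i, rfl⟩ _
      rfl
    rw [Finset.sum_congr rfl fun j _ => hterm j]
    have hK : (Fintype.card κ : ℝ) ≤ d := by
      exact_mod_cast Fintype.card_le_of_surjective blk hblk
    calc ∑ j, ‖z j - y j‖ ^ 2 ≤ ∑ j, (ρ j ^ 2 + 1 / ((d ^ 2 : ℕ) : ℝ)) * e ^ 2 :=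
          Finset.sum_le_sum fun j _ => hy j
      _ = (∑ j, ρ j ^ 2 + Fintype.card κ / d ^ 2) * e ^ 2 := by
          rw [← Finset.sum_mul, Finset.sum_add_distrib]
          simp [div_eq_mul_inv]
      _ ≤ (1 + d / d ^ 2) * e ^ 2 := by gcongr
      _ = a ^ 2 * e ^ 2 := by rw [ha2]; field_simp
      _ = ε ^ 2 := by rw [he]; field_simp
  · have h1 : ((((Fintype.piFinset G).image fun g => (WithLp.toLp 2 fun i => g (blk i) ⟨i, rfl⟩ :
        EuclideanSpace ℝ ι)).card : ℕ) : ℝ) ≤ ∏ j, ((G j).card : ℝ) := by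
      have := Finset.card_image_le (s := Fintype.piFinset G)
        (f := fun g => (WithLp.toLp 2 fun i => g (blk i) ⟨i, rfl⟩ : EuclideanSpace ℝ ι))
      rw [Fintype.card_piFinset] at this
      exact_mod_cast this
    refine h1.trans ?_
    have h2 : (((d ^ 2 : ℕ) : ℝ) + 1) * d ^ 12 ≤ d ^ 16 := by
      push_cast
      have h4 : (d : ℝ) ^ 2 + 1 ≤ d ^ 4 := by
        have : (4 : ℝ) ≤ d ^ 2 := by nlinarith
        nlinarith
      calc ((d : ℝ) ^ 2 + 1) * (d : ℝ) ^ 12 ≤ (d : ℝ) ^ 4 * (d : ℝ) ^ 12 := by gcongr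
        _ = (d : ℝ) ^ 16 := by ring
    have hb0 : ∀ j, 0 ≤ b j := fun j => hε.le.trans (hb j)
    have h3 : ∏ j, (b j / e) ^ Fintype.card {i // blk i = j} = ∏ i, (b (blk i) / e) := by
      rw [← Fintype.prod_fiberwise blk]
      refine Finset.prod_congr rfl fun j _ => ?_
      rw [← Finset.card_univ, ← Finset.prod_const]
      refine Finset.prod_congr rfl fun i _ => ?_
      rw [i.2]
    have h4 : ∏ i, (b (blk i) / e) = a ^ d * ∏ i, (b (blk i) / ε) := by
      rw [hd_def, ← Finset.card_univ, ← Finset.prod_const, ← Finset.prod_mul_distrib]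
      refine Finset.prod_congr rfl fun i _ => ?_
      rw [he]; field_simp
    have h5 : a ^ d ≤ Real.exp 1 := by
      have h6 : a ≤ Real.exp (1 / d) := by
        have : a ≤ a ^ 2 := by nlinarith
        rw [ha2] at this
        linarith [Real.add_one_le_exp (1 / (d : ℝ))]
      calc a ^ d ≤ Real.exp (1 / d) ^ d := by gcongr
        _ = Real.exp (d * (1 / d)) := (Real.exp_nat_mul _ _).symm
        _ = Real.exp 1 := by rw [mul_one_div_cancel (by positivity)]
    calc ∏ j, ((G j).card : ℝ)
        ≤ ∏ j, ((d : ℝ) ^ 16 * (b j / e) ^ Fintype.card {i // blk i = j}) := by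
          refine Finset.prod_le_prod (fun j _ => Nat.cast_nonneg _) fun j _ => ?_
          refine (hGcard j).trans ?_
          rw [hfr]
          have := hb0 j
          gcongr
      _ = ((d : ℝ) ^ 16) ^ Fintype.card κ * (a ^ d * ∏ i, (b (blk i) / ε)) := by
          rw [Finset.prod_mul_distrib, Finset.prod_const, Finset.card_univ, h3, h4]
      _ ≤ _ := by
          have : 0 ≤ ∏ i, (b (blk i) / ε) :=
            Finset.prod_nonneg fun i _ => div_nonneg (hb0 _) hε.le
          gcongr

/-- Metric entropy of an ellipsoid with semi-axes `τ i ≤ 1`: the leading term is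
`∑ log (τ i / ε)` over the semi-axes longer than `ε`. -/
theorem exists_cover_ellipsoid {ι : Type*} [Fintype ι] (τ : ι → ℝ) {ε : ℝ} (hε : 0 < ε)
    (hε1 : ε < 1) (hτ0 : ∀ i, 0 < τ i) (hτ1 : ∀ i, τ i ≤ 1) (hd : 2 ≤ Fintype.card ι)
    (hbig : ∃ i, ε < τ i) :
    ∃ C : Finset (EuclideanSpace ℝ ι),
      (∀ x : EuclideanSpace ℝ ι, ‖x‖ ≤ 1 → ∃ c ∈ C, ∑ i, (τ i * x i - c i) ^ 2 ≤ ε ^ 2) ∧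
      Real.log C.card ≤ ∑ i with ε < τ i, Real.log (τ i / ε) +
        34 * (Real.log (Fintype.card ι) + Real.sqrt (Real.log ε⁻¹ * Real.log (Fintype.card ι) *
          (Finset.univ.filter fun i => ε < τ i).card)) := by
  classical
  set d := Fintype.card ι with hd_def
  set m := (Finset.univ.filter fun i => ε < τ i).card with hm_def
  have hdr : (2 : ℝ) ≤ d := by exact_mod_cast hd
  have hm : (0 : ℝ) < m := by
    obtain ⟨i, hi⟩ := hbig
    exact_mod_cast Finset.card_pos.2 ⟨i, by simpa using hi⟩
  set L := Real.log ε⁻¹ with hL_def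
  have hL : 0 < L := Real.log_pos ((one_lt_inv₀ hε).2 hε1)
  set ld := Real.log d with hld_def
  have hld : 1 / 2 ≤ ld := by
    have h1 : Real.log 2 ≤ ld := Real.log_le_log (by norm_num) hdr
    linarith [Real.log_two_gt_d9]
  have hld0 : 0 < ld := by linarith
  set Q := Real.sqrt (L * ld * m) with hQ
  have hQ0 : 0 < Q := Real.sqrt_pos.2 (by positivity)
  have hQ2 : Q ^ 2 = L * ld * m := Real.sq_sqrt (by positivity)
  -- This step size equates the rounding loss m·h with the block cost (L/h)·ln d; both become `Q`.
  set h := Q / m with hh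
  have hh0 : 0 < h := by positivity
  have hhm : m * h = Q := by rw [hh]; field_simp
  have hLh : L / h * ld = Q := by
    rw [hh, div_div_eq_mul_div, div_mul_eq_mul_div, div_eq_iff hQ0.ne']
    linarith
  -- Short axes join level 0, of radius ε, and contribute a factor 1 to the product of `b / ε`.
  let lev : ι → ℕ := fun i => if ε < τ i then ⌈Real.log (τ i / ε) / h⌉₊ else 0
  let b : ℕ → ℝ := fun k => ε * Real.exp (h * k)
  have hb0 : ∀ k, ε ≤ b k := fun k => le_mul_of_one_le_right hε.le (Real.one_le_exp (by positivity))
  have hτb : ∀ i, τ i ≤ b (lev i) := by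
    intro i
    by_cases hi : ε < τ i
    · have h1 : Real.log (τ i / ε) ≤ h * lev i := by
        have : Real.log (τ i / ε) / h ≤ lev i := by
          simp only [lev, if_pos hi]
          exact Nat.le_ceil _
        rw [div_le_iff₀ hh0] at this
        linarith
      have h2 := Real.exp_le_exp.2 h1
      rw [Real.exp_log (div_pos (hτ0 i) hε), div_le_iff₀ hε] at h2
      simp only [b]
      linarith
    · exact (not_lt.1 hi).trans (hb0 _)
  -- Restricting to the range of `lev` keeps only occupied levels, so no block is empty.
  obtain ⟨C, hC, hcard⟩ := exists_cover_ellipsoid_of_blocks (Set.rangeFactorization lev)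
    Set.rangeFactorization_surjective (fun k => b k.1) τ hε (fun i => (hτ0 i).le)
    (fun i => hτb i) (fun k => hb0 _) hd
  refine ⟨C, hC, ?_⟩
  have hCne : 0 < C.card := by
    obtain ⟨c, hc, -⟩ := hC 0 (by simp)
    exact Finset.card_pos.2 ⟨c, hc⟩
  have hK : (Fintype.card (Set.range lev) : ℝ) ≤ L / h + 2 := by
    have h1 : Fintype.card (Set.range lev) ≤ ⌈L / h⌉₊ + 1 := by
      have hsub : ∀ k : Set.range lev, (k : ℕ) < ⌈L / h⌉₊ + 1 := by
        rintro ⟨_, i, rfl⟩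
        rw [Nat.lt_succ_iff]
        simp only [lev]
        split_ifs with hi
        · have h2 : Real.log (τ i / ε) ≤ L := by
            refine Real.log_le_log (div_pos (hτ0 i) hε) ?_
            rw [div_eq_mul_inv]
            exact mul_le_of_le_one_left (by positivity) (hτ1 i)
          exact Nat.ceil_mono (by gcongr)
        · exact Nat.zero_le _
      simpa using Fintype.card_le_of_injective
        (fun k : Set.range lev => (⟨k, hsub k⟩ : Fin (⌈L / h⌉₊ + 1)))
        fun x y hxy => Subtype.ext (by simpa using hxy)
    have h2 : (⌈L / h⌉₊ : ℝ) < L / h + 1 := Nat.ceil_lt_add_one (by positivity)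
    have h3 : (Fintype.card (Set.range lev) : ℝ) ≤ ⌈L / h⌉₊ + 1 := by exact_mod_cast h1
    linarith
  have hlog : Real.log C.card ≤ Fintype.card (Set.range lev) * (16 * ld) +
      (1 + ∑ i, h * lev i) := by
    refine (Real.log_le_log (by exact_mod_cast hCne) hcard).trans (le_of_eq ?_)
    have hprod : ∏ i, (b (lev i) / ε) = Real.exp (∑ i, h * lev i) := by
      rw [Real.exp_sum]
      refine Finset.prod_congr rfl fun i _ => ?_
      simp only [b]
      field_simp
    change Real.log (_ * (Real.exp 1 * ∏ i, (b (lev i) / ε))) = _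
    rw [hprod, Real.log_mul (by positivity) (by positivity), Real.log_pow, Real.log_pow,
      Real.log_mul (by positivity) (by positivity), Real.log_exp, Real.log_exp]
    push_cast
    rw [← hd_def]
  have hsum : ∑ i, h * (lev i : ℝ) ≤ ∑ i with ε < τ i, Real.log (τ i / ε) + m * h := by
    rw [hm_def, ← nsmul_eq_mul, ← Finset.sum_const, ← Finset.sum_add_distrib, Finset.sum_filter]
    refine Finset.sum_le_sum fun i _ => ?_
    split_ifs with hi
    · have h1 : 0 ≤ Real.log (τ i / ε) := Real.log_nonneg ((one_le_div hε).2 hi.le)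
      have h2 : (lev i : ℝ) < Real.log (τ i / ε) / h + 1 := by
        simp only [lev, if_pos hi]
        exact Nat.ceil_lt_add_one (by positivity)
      have h3 : h * (Real.log (τ i / ε) / h + 1) = Real.log (τ i / ε) + h := by field_simp
      nlinarith
    · simp [lev, if_neg hi]
  have hKld : Fintype.card (Set.range lev) * (16 * ld) ≤ 16 * Q + 32 * ld := by
    calc Fintype.card (Set.range lev) * (16 * ld) ≤ (L / h + 2) * (16 * ld) := by gcongr
      _ = 16 * (L / h * ld) + 32 * ld := by ring
      _ = _ := by rw [hLh]
  -- Blocks give 16Q + 32 ln d, rounding gives Q, and 1 ≤ 2 ln d: hence the constant 34.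
  linarith

/-- The centers of a finite cover of the image of the unit ball can be moved into the image. -/
theorem exists_internal_cover {E F : Type*} [NormedAddCommGroup E] [NormedSpace ℝ E]
    [ProperSpace E] [NormedAddCommGroup F] [InnerProductSpace ℝ F] (T : E →L[ℝ] F)
    (C : Finset F) (hC : C.Nonempty) {r : ℝ}
    (hcov : ∀ x : E, ‖x‖ ≤ 1 → ∃ c ∈ C, ‖T x - c‖ ^ 2 ≤ r) :
    ∃ N : Finset E, N.Nonempty ∧ N.card ≤ C.card ∧ (∀ y ∈ N, ‖y‖ ≤ 1) ∧
      ∀ x : E, ‖x‖ ≤ 1 → ∃ y ∈ N, ‖T (x - y)‖ ^ 2 ≤ r := by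
  classical
  let K : Set F := T '' Metric.closedBall 0 1
  have hKc : IsCompact K := (isCompact_closedBall _ _).image T.continuous
  have hKconv : Convex ℝ K := (convex_closedBall 0 1).linear_image T.toLinearMap
  have hKne : K.Nonempty := ⟨T 0, 0, by simp, rfl⟩
  have hp : ∀ c : F, ∃ y : E, ‖y‖ ≤ 1 ∧ ∀ x : E, ‖x‖ ≤ 1 → ‖T (x - y)‖ ≤ ‖T x - c‖ := by
    intro c
    -- With `v` the nearest point to `c`, the obtuse angle criterion shows that replacing `c` by `v`
    -- brings it no farther from any point of the convex set.
    obtain ⟨v, hv, hmin⟩ := exists_norm_eq_iInf_of_complete_convex hKne hKc.isComplete hKconv c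
    have hin := (norm_eq_iInf_iff_real_inner_le_zero hKconv hv).1 hmin
    obtain ⟨y, hy, rfl⟩ := hv
    refine ⟨y, mem_closedBall_zero_iff.1 hy, fun x hx => ?_⟩
    have h1 := hin (T x) ⟨x, mem_closedBall_zero_iff.2 hx, rfl⟩
    refine (sq_le_sq₀ (norm_nonneg _) (norm_nonneg _)).1 ?_
    have e : T x - c = (T x - T y) - (c - T y) := by abel
    rw [e, norm_sub_sq_real, map_sub, real_inner_comm]
    nlinarith [sq_nonneg ‖c - T y‖]
  choose p hp1 hp2 using hp
  refine ⟨C.image p, hC.image p, Finset.card_image_le, fun y hy => ?_, fun x hx => ?_⟩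
  · obtain ⟨c, -, rfl⟩ := Finset.mem_image.1 hy
    exact hp1 c
  · obtain ⟨c, hc, hxc⟩ := hcov x hx
    refine ⟨p c, Finset.mem_image_of_mem p hc, le_trans ?_ hxc⟩
    gcongr
    exact hp2 c x hx

/-! ### The quadratic form in an eigenbasis. -/

section Spectrum

variable {d : ℕ} {S : Matrix (Fin d) (Fin d) ℝ}

theorem matrixNormSq_eq_sum_eigenvalues (hS : S.IsHermitian) (x : EuclideanSpace ℝ (Fin d)) :
    matrixNormSq S x = ∑ i, hS.eigenvalues i * hS.eigenvectorBasis.repr x i ^ 2 := by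
  have h1 : matrixNormSq S x = inner ℝ x (WithLp.toLp 2 (S.mulVec x.ofLp)) := by
    rw [matrixNormSq, EuclideanSpace.inner_eq_star_dotProduct, dotProduct_comm]
    simp
  rw [h1, ← hS.eigenvectorBasis.sum_inner_mul_inner]
  refine Finset.sum_congr rfl fun i _ => ?_
  have h2 : inner ℝ (hS.eigenvectorBasis i) (WithLp.toLp 2 (S.mulVec x.ofLp))
      = hS.eigenvalues i * hS.eigenvectorBasis.repr x i := by
    rw [OrthonormalBasis.repr_apply_apply, EuclideanSpace.inner_eq_star_dotProduct,
      EuclideanSpace.inner_eq_star_dotProduct]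
    simp only [star_trivial]
    rw [dotProduct_comm, Matrix.dotProduct_mulVec, ← Matrix.mulVec_transpose]
    have : S.transpose = S := by rw [← Matrix.conjTranspose_eq_transpose_of_trivial]; exact hS
    rw [this, hS.mulVec_eigenvectorBasis, smul_dotProduct, smul_eq_mul, dotProduct_comm]
  rw [h2, real_inner_comm, ← OrthonormalBasis.repr_apply_apply]
  ring

theorem exists_orthonormalBasis_matrixNormSq (hS : S.PosSemidef) :
    ∃ v : OrthonormalBasis (Fin d) ℝ (EuclideanSpace ℝ (Fin d)),
      ∀ x, matrixNormSq S x = ∑ i, (specScale hS i * v.repr x i) ^ 2 := by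
  -- `eigenvalues` is listed through an unspecified enumeration of the index type; `e` converts it
  -- to the sorted order of `specScale`.
  let e : Fin d ≃ Fin d :=
    (Fintype.equivOfCardEq (Fintype.card_fin _)).symm.trans (finCongr (Fintype.card_fin d))
  refine ⟨hS.isHermitian.eigenvectorBasis.reindex e, fun x => ?_⟩
  rw [matrixNormSq_eq_sum_eigenvalues hS.isHermitian,
    ← Equiv.sum_comp e fun i => (specScale hS i * _) ^ 2]
  refine Finset.sum_congr rfl fun i _ => ?_
  have h1 : specScale hS (e i) ^ 2 = hS.isHermitian.eigenvalues i := by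
    have : specScale hS (e i) = Real.sqrt (hS.isHermitian.eigenvalues i) := rfl
    rw [this, Real.sq_sqrt (hS.eigenvalues_nonneg i)]
  rw [mul_pow, h1, OrthonormalBasis.repr_apply_apply, OrthonormalBasis.repr_apply_apply,
    OrthonormalBasis.reindex_apply, Equiv.symm_apply_apply]

theorem specScale_antitone (hS : S.PosSemidef) : Antitone (specScale hS) := fun i j hij =>
  Real.sqrt_le_sqrt (hS.isHermitian.eigenvalues₀_antitone (by simpa using hij))

theorem specScale_pos (hS : S.PosDef) (i : Fin d) : 0 < specScale hS.posSemidef i := by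
  let f := Fintype.equivOfCardEq (Fintype.card_fin (Fintype.card (Fin d)))
  have h := hS.eigenvalues_pos (f (Fin.cast (Fintype.card_fin d).symm i))
  refine Real.sqrt_pos.2 (lt_of_lt_of_eq h ?_)
  simp [Matrix.IsHermitian.eigenvalues, f]

variable [NeZero d]

theorem largeCount_eq_card_filter (hS : S.PosSemidef) (ε : ℝ) :
    largeCount hS ε
      = (Finset.univ.filter fun i => ε * specScale hS 0 < specScale hS i).card := by
  rw [largeCount, Nat.card_eq_fintype_card, Fintype.card_subtype]

/-- By monotonicity the indices above the threshold form an initial segment. -/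
theorem filter_val_lt_largeCount (hS : S.PosSemidef) (ε : ℝ) :
    (Finset.univ.filter fun i : Fin d => i.val < largeCount hS ε)
      = Finset.univ.filter fun i => ε * specScale hS 0 < specScale hS i := by
  symm
  refine Finset.eq_of_subset_of_card_le ?_ ?_
  · intro i hi
    rw [Finset.mem_filter] at hi
    refine Finset.mem_filter.2 ⟨Finset.mem_univ _, ?_⟩
    have hsub : Finset.Iic i ⊆ Finset.univ.filter fun i => ε * specScale hS 0 < specScale hS i :=
      fun j hj => Finset.mem_filter.2 ⟨Finset.mem_univ _,
        hi.2.trans_le (specScale_antitone hS (Finset.mem_Iic.1 hj))⟩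
    have := Finset.card_le_card hsub
    rw [Fin.card_Iic] at this
    rw [largeCount_eq_card_filter]
    omega
  · rw [← largeCount_eq_card_filter]
    calc _ ≤ (Finset.range (largeCount hS ε)).card :=
          Finset.card_le_card_of_injOn Fin.val (fun i hi => by simpa using hi)
            Fin.val_injective.injOn
      _ = _ := Finset.card_range _

end Spectrum

/-! ### Bounds through the effective dimension. -/

section EffectiveDimension

variable {d : ℕ} [NeZero d] {a : Fin d → ℝ} {ε p : ℝ}

theorem one_le_rpow_mul_rpow_of_lt {t : ℝ} (hε : 0 < ε) (hp : 0 < p) (ht : ε < t) :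
    1 ≤ ε ^ (-p) * t ^ p := by
  rw [Real.rpow_neg hε.le, inv_mul_eq_div, ← Real.div_rpow (hε.trans ht).le hε.le]
  exact Real.one_le_rpow ((one_le_div hε).2 ht.le) hp.le

/-- Index 0 accounts for the 1; for the others the indicator of ε < aᵢ is at most (aᵢ/ε)^p. -/
theorem card_filter_lt_le (ha : ∀ i, 0 < a i) (ha0 : a 0 = 1) (hε : 0 < ε) (hp : 0 < p) :
    ((Finset.univ.filter fun i => ε < a i).card : ℝ) ≤
      1 + (∑ i, a i ^ p - 1) * ε ^ (-p) := by
  have hsplit : ∑ i, a i ^ p - 1 = ∑ i ∈ Finset.univ.erase 0, a i ^ p := by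
    rw [← Finset.add_sum_erase _ _ (Finset.mem_univ (0 : Fin d)), ha0, Real.one_rpow]; ring
  rw [hsplit, Finset.card_filter]
  push_cast
  rw [← Finset.add_sum_erase _ _ (Finset.mem_univ (0 : Fin d)), Finset.sum_mul]
  refine add_le_add (by split_ifs <;> norm_num) (Finset.sum_le_sum fun i _ => ?_)
  have h0 : 0 < a i ^ p := Real.rpow_pos_of_pos (ha i) _
  have h1 : 0 < ε ^ (-p) := Real.rpow_pos_of_pos hε _
  split_ifs with hi
  · rw [mul_comm]
    exact one_le_rpow_mul_rpow_of_lt hε hp hi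
  · positivity

/-- Index 0 gives ln ε⁻¹. For the others put z = (aᵢ/ε)^p and use ln z ≤ z/s + ln s - 1, the tangent
to the logarithm at s, then sum over i and choose s. -/
theorem sum_log_div_le (hd : 2 ≤ d) (ha : ∀ i, 0 < a i) (ha0 : a 0 = 1) (hε : 0 < ε)
    (hε1 : ε ≤ 1) (hp : 0 < p) :
    ∑ i with ε < a i, Real.log (a i / ε) ≤ Real.log ε⁻¹ +
      min ((d : ℝ) - 1) (ε ^ (-p) * ((∑ i, a i ^ p - 1) / Real.exp 1)) / p *
        Real.log (max (Real.exp 1) (ε ^ (-p) * ((∑ i, a i ^ p - 1) / ((d : ℝ) - 1)))) := by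
  have hdr : (2 : ℝ) ≤ d := by exact_mod_cast hd
  set n : ℝ := (d : ℝ) - 1 with hn
  have hn0 : 0 < n := by linarith
  have hsplit : ∑ i, a i ^ p - 1 = ∑ i ∈ Finset.univ.erase 0, a i ^ p := by
    rw [← Finset.add_sum_erase _ _ (Finset.mem_univ (0 : Fin d)), ha0, Real.one_rpow]; ring
  rw [hsplit, ← mul_div_assoc, ← mul_div_assoc, Finset.mul_sum]
  set A := ∑ i ∈ Finset.univ.erase 0, ε ^ (-p) * a i ^ p with hA
  -- A/n is the optimal point of tangency; the cutoff at exp 1 keeps ln s - 1 nonnegative, as the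
  -- indices with aᵢ ≤ ε require.
  set s := max (Real.exp 1) (A / n) with hs
  have hs1 : Real.exp 1 ≤ s := le_max_left _ _
  have hs0 : 0 < s := (Real.exp_pos 1).trans_le hs1
  have hlogs : 1 ≤ Real.log s := (Real.le_log_iff_exp_le hs0).2 hs1
  have hterm : ∀ i, (if ε < a i then Real.log (a i / ε) else 0) ≤
      (ε ^ (-p) * a i ^ p / s + (Real.log s - 1)) / p := by
    intro i
    have h0 : 0 < ε ^ (-p) * a i ^ p :=
      mul_pos (Real.rpow_pos_of_pos hε _) (Real.rpow_pos_of_pos (ha i) _)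
    split_ifs with hi
    · have h1 : Real.log (a i / ε) = Real.log (ε ^ (-p) * a i ^ p) / p := by
        rw [Real.rpow_neg hε.le, inv_mul_eq_div, ← Real.div_rpow (ha i).le hε.le,
          Real.log_rpow (div_pos (ha i) hε)]
        field_simp
      rw [h1]
      gcongr
      have h2 := Real.log_le_sub_one_of_pos (div_pos h0 hs0)
      rw [Real.log_div h0.ne' hs0.ne'] at h2
      linarith
    · apply div_nonneg _ hp.le
      have : 0 < ε ^ (-p) * a i ^ p / s := div_pos h0 hs0
      linarith
  have hcard : ((Finset.univ.erase (0 : Fin d)).card : ℝ) = n := by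
    rw [Finset.card_erase_of_mem (Finset.mem_univ _), Finset.card_univ, Fintype.card_fin,
      Nat.cast_sub (by omega), Nat.cast_one]
  have hopt : A / s + n * (Real.log s - 1) ≤ min n (A / Real.exp 1) * Real.log s := by
    rcases le_total (A / n) (Real.exp 1) with h | h
    · have hse : s = Real.exp 1 := max_eq_left h
      have h2 : A / Real.exp 1 ≤ n := by
        rw [div_le_iff₀ hn0] at h
        rw [div_le_iff₀ (Real.exp_pos 1)]
        linarith
      rw [hse, Real.log_exp, min_eq_right h2]
      linarith
    · have hse : s = A / n := max_eq_right h
      have h2 : n ≤ A / Real.exp 1 := by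
        rw [le_div_iff₀ hn0] at h
        rw [le_div_iff₀ (Real.exp_pos 1)]
        linarith
      have hA0 : A ≠ 0 := by
        rintro h0
        rw [h0, zero_div] at h
        exact absurd h (not_le.2 (Real.exp_pos 1))
      have h3 : A / s = n := by rw [hse]; field_simp
      rw [h3, min_eq_left h2]
      linarith
  rw [Finset.sum_filter, ← Finset.add_sum_erase _ _ (Finset.mem_univ (0 : Fin d))]
  refine add_le_add ?_ ?_
  · rw [ha0, one_div]
    split_ifs
    · exact le_rfl
    · exact Real.log_nonneg ((one_le_inv₀ hε).2 hε1)
  · refine (Finset.sum_le_sum fun i _ => hterm i).trans ?_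
    rw [← Finset.sum_div, Finset.sum_add_distrib, ← Finset.sum_div, Finset.sum_const, nsmul_eq_mul,
      hcard, ← hA, div_mul_eq_mul_div]
    gcongr

end EffectiveDimension

/-! ### Assembly. -/

section Main

variable {d : ℕ} [NeZero d] {S : Matrix (Fin d) (Fin d) ℝ}

theorem matrixNormSq_le_specScale_sq (hS : S.PosSemidef) {x : EuclideanSpace ℝ (Fin d)}
    (hx : ‖x‖ ≤ 1) : matrixNormSq S x ≤ specScale hS 0 ^ 2 := by
  obtain ⟨v, hv⟩ := exists_orthonormalBasis_matrixNormSq hS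
  have h1 : ∑ i, v.repr x i ^ 2 ≤ 1 := by
    rw [← EuclideanSpace.real_norm_sq_eq, v.repr.norm_map]
    exact pow_le_one₀ (norm_nonneg _) hx
  calc matrixNormSq S x = ∑ i, specScale hS i ^ 2 * v.repr x i ^ 2 := by simp_rw [hv, mul_pow]
    _ ≤ ∑ i, specScale hS 0 ^ 2 * v.repr x i ^ 2 := by
      refine Finset.sum_le_sum fun i _ => ?_
      have h2 : specScale hS i ≤ specScale hS 0 := specScale_antitone hS (Fin.zero_le _)
      have h3 : 0 ≤ specScale hS i := Real.sqrt_nonneg _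
      gcongr
    _ = specScale hS 0 ^ 2 * ∑ i, v.repr x i ^ 2 := by rw [Finset.mul_sum]
    _ ≤ _ := mul_le_of_le_one_right (sq_nonneg _) h1

theorem filter_lt_specScale_div (hS : S.PosDef) (ε : ℝ) :
    (Finset.univ.filter fun i => ε < specScale hS.posSemidef i / specScale hS.posSemidef 0)
      = Finset.univ.filter fun i =>
        ε * specScale hS.posSemidef 0 < specScale hS.posSemidef i :=
  Finset.filter_congr fun _ _ => lt_div_iff₀ (specScale_pos hS 0)

theorem entropyBound_eq (hS : S.PosDef) (c ε : ℝ) :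
    entropyBound hS.posSemidef c ε =
      ∑ i with ε < specScale hS.posSemidef i / specScale hS.posSemidef 0,
        Real.log (specScale hS.posSemidef i / specScale hS.posSemidef 0 / ε)
      + entropyRemainder hS.posSemidef c ε := by
  rw [entropyBound, filter_val_lt_largeCount, filter_lt_specScale_div hS]
  congr 1
  refine Finset.sum_congr rfl fun i _ => ?_
  rw [div_div, mul_comm ε]

theorem exists_net_matrixNormSq (hd : 2 ≤ d) (hS : S.PosDef) {ε : ℝ} (hε : 0 < ε) :
    ∃ N : Finset (EuclideanSpace ℝ (Fin d)),
      (∀ y ∈ N, y ∈ Metric.closedBall (0 : EuclideanSpace ℝ (Fin d)) 1) ∧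
      (∀ x ∈ Metric.closedBall (0 : EuclideanSpace ℝ (Fin d)) 1, ∃ y ∈ N,
        matrixNormSq S (x - y) ≤ ε ^ 2 * specScale hS.posSemidef 0 ^ 2) ∧
      Real.log (N.card : ℝ) ≤ entropyBound hS.posSemidef 34 ε := by
  set σ := specScale hS.posSemidef with hσ
  have hσ0 : ∀ i, 0 < σ i := specScale_pos hS
  have hdr : (2 : ℝ) ≤ d := by exact_mod_cast hd
  rw [entropyBound_eq hS, ← hσ]
  -- For ε ≥ 1 the origin alone is a net, and the entropy bound is nonnegative because `Real.sqrt`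
  -- is.
  rcases le_or_gt 1 ε with h1 | h1
  · refine ⟨{0}, by simp, fun x hx => ⟨0, by simp, ?_⟩, ?_⟩
    · rw [sub_zero]
      refine (matrixNormSq_le_specScale_sq hS.posSemidef (mem_closedBall_zero_iff.1 hx)).trans ?_
      exact le_mul_of_one_le_left (sq_nonneg _) (one_le_pow₀ h1)
    · rw [Finset.card_singleton, Nat.cast_one, Real.log_one]
      refine add_nonneg (Finset.sum_nonneg fun i hi => Real.log_nonneg ?_) ?_
      · rw [one_le_div hε]
        exact (Finset.mem_filter.1 hi).2.le
      · have : 0 ≤ Real.log d := Real.log_nonneg (by linarith)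
        rw [entropyRemainder]
        positivity
  · let τ : Fin d → ℝ := fun i => σ i / σ 0
    have hτ1 : ∀ i, τ i ≤ 1 := fun i =>
      (div_le_one (hσ0 0)).2 (specScale_antitone hS.posSemidef (Fin.zero_le _))
    have hτ0 : τ 0 = 1 := div_self (hσ0 0).ne'
    obtain ⟨C, hC, hcard⟩ := exists_cover_ellipsoid τ hε h1 (fun i => div_pos (hσ0 i) (hσ0 0)) hτ1
      (by rwa [Fintype.card_fin]) ⟨0, by rwa [hτ0]⟩
    obtain ⟨v, hv⟩ := exists_orthonormalBasis_matrixNormSq hS.posSemidef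
    let D : EuclideanSpace ℝ (Fin d) →ₗ[ℝ] EuclideanSpace ℝ (Fin d) :=
      { toFun := fun x => WithLp.toLp 2 fun i => τ i * v.repr x i
        map_add' := fun x y => by ext i; simp [mul_add]
        map_smul' := fun r x => by ext i; simp; ring }
    let T := LinearMap.toContinuousLinearMap D
    have hT : ∀ x i, T x i = τ i * v.repr x i := fun x i => rfl
    have hCne : C.Nonempty := by
      obtain ⟨c, hc, -⟩ := hC 0 (by simp)
      exact ⟨c, hc⟩
    obtain ⟨N, hNne, hNC, hN1, hN2⟩ := exists_internal_cover T C hCne (r := ε ^ 2) (fun x hx => by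
      obtain ⟨c, hc, hxc⟩ := hC (v.repr x) (by rwa [v.repr.norm_map])
      refine ⟨c, hc, ?_⟩
      rw [EuclideanSpace.real_norm_sq_eq]
      exact hxc)
    refine ⟨N, fun y hy => mem_closedBall_zero_iff.2 (hN1 y hy), fun x hx => ?_, ?_⟩
    · obtain ⟨y, hy, hxy⟩ := hN2 x (mem_closedBall_zero_iff.1 hx)
      refine ⟨y, hy, ?_⟩
      have h2 : matrixNormSq S (x - y) = ‖T (x - y)‖ ^ 2 * σ 0 ^ 2 := by
        rw [hv, ← hσ, EuclideanSpace.real_norm_sq_eq, Finset.sum_mul]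
        refine Finset.sum_congr rfl fun i _ => ?_
        have := (hσ0 0).ne'
        rw [hT, ← mul_pow]
        simp only [τ]
        field_simp
      rw [h2]
      gcongr
    · have h3 : Real.log N.card ≤ Real.log C.card :=
        Real.log_le_log (by exact_mod_cast hNne.card_pos) (by exact_mod_cast hNC)
      refine (h3.trans hcard).trans (le_of_eq ?_)
      rw [entropyRemainder, largeCount_eq_card_filter, ← filter_lt_specScale_div hS, Fintype.card_fin]

end Main

theorem corollary1 :
    ∃ c : ℝ, 0 < c ∧
      ∀ (d : ℕ) [NeZero d], 2 ≤ d →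
      ∀ (S : Matrix (Fin d) (Fin d) ℝ) (hS : S.PosDef)
        (Ω : Type*) [MeasurableSpace Ω] (P : Measure Ω) [IsProbabilityMeasure P]
        (a : Ω → EuclideanSpace ℝ (Fin d)), AEMeasurable a P → IsMatrixSubgaussian P S a →
      ∀ ε : ℝ, 0 < ε →
        -- the net of the unit ball, an `ε σ₁`-cover of the unit ball in the `S`-norm
        (∃ N : Finset (EuclideanSpace ℝ (Fin d)),
          (∀ y ∈ N, y ∈ Metric.closedBall (0 : EuclideanSpace ℝ (Fin d)) 1) ∧
          (∀ x ∈ Metric.closedBall (0 : EuclideanSpace ℝ (Fin d)) 1, ∃ y ∈ N,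
            matrixNormSq S (x - y) ≤ ε ^ 2 * specScale hS.posSemidef 0 ^ 2) ∧
          Real.log (N.card : ℝ) ≤ entropyBound hS.posSemidef c ε) ∧
        -- the bounds through the effective dimension
        (∀ r : ℕ, 1 ≤ r →
          (ε ≤ 1 →
            entropyBound hS.posSemidef c ε ≤
              Real.log ε⁻¹ +
                min ((d : ℝ) - 1)
                    (ε ^ (-(2 / (r : ℝ))) * ((effDim hS.posSemidef r - 1) / Real.exp 1)) /
                  (2 / (r : ℝ)) *
                Real.log (max (Real.exp 1)
                  (ε ^ (-(2 / (r : ℝ))) * ((effDim hS.posSemidef r - 1) / ((d : ℝ) - 1)))) +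
                entropyRemainder hS.posSemidef c ε) ∧
          (largeCount hS.posSemidef ε : ℝ) ≤
            1 + (effDim hS.posSemidef r - 1) * ε ^ (-(2 / (r : ℝ)))) := by
  refine ⟨34, by norm_num, fun d _ hd S hS Ω _ P _ a _ _ ε hε =>
    ⟨exists_net_matrixNormSq hd hS hε, fun r hr => ?_⟩⟩
  have hp : (0 : ℝ) < 2 / (r : ℝ) := by positivity
  have hpos : ∀ i, 0 < specScale hS.posSemidef i / specScale hS.posSemidef 0 := fun i =>
    div_pos (specScale_pos hS i) (specScale_pos hS 0)
  have hone : specScale hS.posSemidef 0 / specScale hS.posSemidef 0 = 1 :=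
    div_self (specScale_pos hS 0).ne'
  refine ⟨fun hε1 => ?_, ?_⟩
  · rw [entropyBound_eq hS]
    exact add_le_add_left (sum_log_div_le hd hpos hone hε hε1 hp) _
  · rw [largeCount_eq_card_filter, ← filter_lt_specScale_div hS]
    exact card_filter_lt_le hpos hone hε hp
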